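/- Let $\mathcal X,\mathcal Y,\mathcal A,\mathcal B$ be finite sets and let $\mathbf p=p(a,b|x,y)$ be a family of probability distributions on $\mathcal A\times\mathcal B$, one for each $(x,y)\in\mathcal X\times\mathcal Y$. Let $\bot\notin\mathcal A$ be an abort symbol, which only Alice may output. - A local deterministic strategy in which only Alice may abort is a pair of functions $f:\mathcal X\to\mathcal A\cup\{\bot\}$, $g:\mathcal Y\to\mathcal B$; its distribution is $\ell(a,b|x,y)=1$ if $f(x)=a$ and $g(y)=b$, and $0$ otherwise. $\mathcal L_{\det}^{\bot A}$ is the set of these. - A quantum distribution in which only Alice may abort is one of the form $q(a,b|x,y)=\mathrm{Tr}\big(\rho\,(E_x^a\otimes F_y^b)\big)$, where $\rho$ is a density matrix on $\mathbb C^m\otimes\mathbb C^n$ for some $m,n\in\mathbb N$, $(E_x^a)_{a\in\mathcal A\cup\{\bot\}}$ is a POVM on $\mathbb C^m$ for each $x$, and $(F_y^b)_{b\in\mathcal B}$ is a POVM on $\mathbb C^n$ for each $y$. $\mathcal Q^{\bot A}$ is the set of these. Define the one-way efficiency bounds $\mathrm{eff}^{\rightarrow}(\mathbf p),\mathrm{eff}^{*,\rightarrow}(\mathbf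 p)\in[0,\infty]$ (with $1/0=\infty$, $1/\infty=0$) by $$\frac1{\mathrm{eff}^{\rightarrow}(\mathbf p)}=\sup\Big\{\zeta\ge 0:\ \exists\,(q_\ell)_{\ell\in\mathcal L_{\det}^{\bot A}},\ q_\ell\ge 0,\ \sum_\ell q_\ell=1,\ \sum_\ell q_\ell\,\ell(a,b|x,y)=\zeta\,p(a,b|x,y)\ \ \forall a\in\mathcal A,b\in\mathcal B,x\in\mathcal X,y\in\mathcal Y\Big\},$$ $$\frac1{\mathrm{eff}^{*,\rightarrow}(\mathbf p)}=\sup\Big\{\zeta\ge 0:\ \exists\,\mathbf q\in\mathcal Q^{\bot A},\ q(a,b|x,y)=\zeta\,p(a,b|x,y)\ \ \forall a\in\mathcal A,b\in\mathcal B,x\in\mathcal X,y\in\mathcal Y\Big\}.$$ Let $R_0^{\rightarrow}(\mathbf p)$ be the least $t\in\mathbb N$ such that $\mathbf p$ is the exact output distribution of a one-way protocol with shared randomness, that is, a convex combination of deterministic protocols in which Alice, on input $x$, sends $t$ bits to Bob and outputs some $a\in\mathcal A$, and Bob outputs some $b\in\mathcal B$ that depends on $y$ and on the message. Let $Q_0^{*,\rightarrow}(\mathbf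 p)$ be the least $t\in\mathbb N$ such that $\mathbf p$ is the exact output distribution of a one-way quantum protocol with shared entanglement: the players share a bipartite state on $\mathbb C^m\otimes\mathbb C^n$ for some $m,n$; on input $x$ Alice applies to her part a quantum instrument whose classical outcome is her output $a$ and whose quantum output is a $t$-qubit register, which she sends to Bob; on input $y$ Bob measures this register jointly with his part of the shared state by a POVM, whose outcome is his output $b$. Both quantities are $\infty$ if there is no such $t$. Then, with $\log$ the base 2 logarithm, $\log 0=-\infty$ and $\log\infty=\infty$, $$R_0^{\rightarrow}(\mathbf p)\ \ge\ \log \mathrm{eff}^{\rightarrow}(\mathbf p)\qquad\text{and}\qquad Q_0^{*,\rightarrow}(\mathbf p)\ \ge\ \tfrac12\log \mathrm{eff}^{*,\rightarrow}(\mathbf p).$$ -/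

import Mathlib

open scoped ENNReal NNReal Kronecker ComplexOrder

/-- A family of probability distributions `p(a,b|x,y)` on pairs of outputs `(a,b)`, one for each
pair of inputs `(x,y)`. -/
structure CondDist (X Y A B : Type*) [Fintype A] [Fintype B] where
  prob : X → Y → A → B → ℝ
  nonneg : ∀ x y a b, 0 ≤ prob x y a b
  sum_eq_one : ∀ x y, ∑ a, ∑ b, prob x y a b = 1

/-! ### Base 2 logarithm with values in the extended reals -/

/-- The base 2 logarithm on `[0,∞]`, with `log2 0 = -∞` and `log2 ∞ = ∞`. -/
noncomputable def log2 (z : ℝ≥0∞) : EReal := ENNReal.log z / ((Real.log 2 : ℝ) : EReal)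

/-! ### Zero-communication strategies -/

/-- A local deterministic strategy: each player's output is a function of her or his own input. -/
abbrev LocalDet (X Y A B : Type*) := (X → A) × (Y → B)

/-- The distribution `ℓ(a,b|x,y) ∈ {0,1}` of a local deterministic strategy. -/
def LocalDet.prob {X Y A B : Type*} [DecidableEq A] [DecidableEq B] (l : LocalDet X Y A B)
    (x : X) (y : Y) (a : A) (b : B) : ℝ :=
  if l.1 x = a ∧ l.2 y = b then 1 else 0

/-- A density matrix: positive semidefinite with trace one. -/
def IsDensity {d : Type*} [Fintype d] (ρ : Matrix d d ℂ) : Prop :=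
  ρ.PosSemidef ∧ ρ.trace = 1

/-- A measurement (POVM) with outcomes in `O`. -/
def IsPOVM {O d : Type*} [Fintype O] [Fintype d] [DecidableEq d] (E : O → Matrix d d ℂ) : Prop :=
  (∀ o, (E o).PosSemidef) ∧ ∑ o, E o = 1

/-- Quantum distributions: those that arise when the players share a bipartite state on
`ℂ^m ⊗ ℂ^n` and each applies to her or his part a measurement that depends on the own input,
`q(a,b|x,y) = Tr (ρ (E_x^a ⊗ F_y^b))`. -/
def IsQuantum {X Y A B : Type*} [Fintype A] [Fintype B] (q : X → Y → A → B → ℝ) : Prop :=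
  ∃ (m n : ℕ) (ρ : Matrix (Fin m × Fin n) (Fin m × Fin n) ℂ)
    (E : X → A → Matrix (Fin m) (Fin m) ℂ) (F : Y → B → Matrix (Fin n) (Fin n) ℂ),
    IsDensity ρ ∧ (∀ x, IsPOVM (E x)) ∧ (∀ y, IsPOVM (F y)) ∧
      ∀ x y a b, ((q x y a b : ℝ) : ℂ) = (ρ * (E x a ⊗ₖ F y b)).trace

/-! ### One-way efficiency bounds

Only Alice may abort: her outputs lie in `Option A`, where `none` is the abort symbol `⊥`, while
Bob's outputs lie in `B`. -/

section Efficiency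

variable {X Y A B : Type*} [Fintype A] [Fintype B]

/-- `ζ` is feasible for the classical one-way program: some convex combination of local
deterministic strategies in which only Alice may abort has
`∑_ℓ q_ℓ ℓ(a,b|x,y) = ζ p(a,b|x,y)` for all non-abort outputs `a`, `b`. -/
def OneWayFeasible [Fintype X] [Fintype Y] [DecidableEq X] [DecidableEq Y] [DecidableEq A]
    [DecidableEq B] (p : CondDist X Y A B) (ζ : ℝ≥0) : Prop :=
  ∃ w : LocalDet X Y (Option A) B → ℝ, (∀ l, 0 ≤ w l) ∧ ∑ l, w l = 1 ∧
    ∀ x y a b, ∑ l, w l * l.prob x y (some a) b = ζ * p.prob x y a b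

/-- The classical one-way efficiency bound, the inverse of the optimal efficiency; it is `∞` when
the optimal efficiency is `0`. -/
noncomputable def effOneWay [Fintype X] [Fintype Y] [DecidableEq X] [DecidableEq Y] [DecidableEq A]
    [DecidableEq B] (p : CondDist X Y A B) : ℝ≥0∞ :=
  (⨆ (ζ : ℝ≥0) (_ : OneWayFeasible p ζ), (ζ : ℝ≥0∞))⁻¹

/-- `ζ` is feasible for the quantum one-way program: some quantum distribution in which only Alice
may abort has `q(a,b|x,y) = ζ p(a,b|x,y)` for all non-abort outputs `a`, `b`. -/
def QOneWayFeasible (p : CondDist X Y A B) (ζ : ℝ≥0) : Prop :=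
  ∃ q : X → Y → Option A → B → ℝ, IsQuantum q ∧
    ∀ x y a b, q x y (some a) b = ζ * p.prob x y a b

/-- The quantum one-way efficiency bound, the inverse of the optimal efficiency. -/
noncomputable def qEffOneWay (p : CondDist X Y A B) : ℝ≥0∞ :=
  (⨆ (ζ : ℝ≥0) (_ : QOneWayFeasible p ζ), (ζ : ℝ≥0∞))⁻¹

end Efficiency

/-! ### One-way communication protocols -/

/-- A one-way randomized protocol with shared randomness and `t` bits of communication, that is, a
convex combination of deterministic protocols. The players share a random seed `s`; Alice sends the
`t`-bit message `msg s x` and outputs `outA s x`; Bob, on receiving `μ`, outputs `outB s y μ`.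
(Private coins can be made part of the seed.) -/
structure OneWayProtocol (X Y A B : Type*) (t : ℕ) where
  seeds : ℕ
  seedProb : Fin seeds → ℝ
  seedProb_nonneg : ∀ s, 0 ≤ seedProb s
  seedProb_sum : ∑ s, seedProb s = 1
  msg : Fin seeds → X → (Fin t → Bool)
  outA : Fin seeds → X → A
  outB : Fin seeds → Y → (Fin t → Bool) → B

/-- The probability that the players output `(a,b)` on inputs `(x,y)`. -/
def OneWayProtocol.prob {X Y A B : Type*} [DecidableEq A] [DecidableEq B] {t : ℕ}
    (P : OneWayProtocol X Y A B t) (x : X) (y : Y) (a : A) (b : B) : ℝ :=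
  ∑ s, if P.outA s x = a ∧ P.outB s y (P.msg s x) = b then P.seedProb s else 0

/-- A one-way quantum protocol with shared entanglement and `t` qubits of communication.
The players share a state `ρ` on `ℂ^m ⊗ ℂ^n`. On input `x` Alice applies to her part a quantum
instrument that yields her classical output `a` and a `t`-qubit register; the completely positive
map for the outcome `a` is `σ ↦ ∑ k, K_{x,a,k} σ K_{x,a,k}ᴴ`. She sends the register, and on
input `y` Bob obtains his output by measuring the register together with his part of `ρ`. -/
structure QOneWayProtocol (X Y A B : Type*) [Fintype A] [Fintype B] (t : ℕ) where
  m : ℕ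
  n : ℕ
  ρ : Matrix (Fin m × Fin n) (Fin m × Fin n) ℂ
  isDensity : IsDensity ρ
  r : ℕ
  K : X → A → Fin r → Matrix (Fin t → Bool) (Fin m) ℂ
  kraus_sum : ∀ x, ∑ a, ∑ k, (K x a k).conjTranspose * K x a k = 1
  F : Y → B → Matrix ((Fin t → Bool) × Fin n) ((Fin t → Bool) × Fin n) ℂ
  isPOVM : ∀ y, IsPOVM (F y)

/-- The unnormalized joint state of the message register and of Bob's part of the shared state
after Alice has obtained the output `a` on input `x`. -/
noncomputable def QOneWayProtocol.post {X Y A B : Type*} [Fintype A] [Fintype B] {t : ℕ}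
    (P : QOneWayProtocol X Y A B t) (x : X) (a : A) :
    Matrix ((Fin t → Bool) × Fin P.n) ((Fin t → Bool) × Fin P.n) ℂ :=
  ∑ k, (P.K x a k ⊗ₖ (1 : Matrix (Fin P.n) (Fin P.n) ℂ)) * P.ρ *
    (P.K x a k ⊗ₖ (1 : Matrix (Fin P.n) (Fin P.n) ℂ)).conjTranspose

/-- The probability that the players output `(a,b)` on inputs `(x,y)`, as a complex number. -/
noncomputable def QOneWayProtocol.prob {X Y A B : Type*} [Fintype A] [Fintype B] {t : ℕ}
    (P : QOneWayProtocol X Y A B t) (x : X) (y : Y) (a : A) (b : B) : ℂ :=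
  (P.post x a * P.F y b).trace

/-- The one-way classical communication complexity of simulating `p` exactly with shared
randomness; it is `∞` when no such protocol exists. -/
noncomputable def oneWayComplexity {X Y A B : Type*} [Fintype A] [Fintype B] [DecidableEq A]
    [DecidableEq B] (p : CondDist X Y A B) : EReal :=
  ⨅ (t : ℕ) (_ : ∃ P : OneWayProtocol X Y A B t, ∀ x y a b, P.prob x y a b = p.prob x y a b),
    (t : EReal)

/-- The one-way quantum communication complexity, in qubits, of simulating `p` exactly with shared
entanglement; it is `∞` when no such protocol exists. -/
noncomputable def qOneWayComplexity {X Y A B : Type*} [Fintype A] [Fintype B]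
    (p : CondDist X Y A B) : EReal :=
  ⨅ (t : ℕ) (_ : ∃ P : QOneWayProtocol X Y A B t,
      ∀ x y a b, P.prob x y a b = ((p.prob x y a b : ℝ) : ℂ)), (t : EReal)

/-! ### Efficiency bounds from feasible values -/

/-! A communication protocol becomes a zero-communication strategy in which Alice aborts except with
a fixed probability `ζ`, independent of the inputs and of the outputs; conditioned on no abort, the
outputs follow `p`. So `ζ` is feasible, and `log2_inv_iSup_le` turns this into a bound that holds
for every admissible `t`. Classically the message is replaced by a shared uniform guess, right with
probability `2⁻ᵗ`. Only Alice can check it, so only she needs to abort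
(`OneWayProtocol.oneWayFeasible`). In the quantum case the message register is teleported through a
shared maximally entangled pair of dimension `2ᵗ`. Alice keeps the one Bell outcome that needs no
correction, which has probability `4⁻ᵗ` whatever the register's state (`trace_teleport`); Bob
measures his half as if it were the message. -/

theorem log2_mono {y z : ℝ≥0∞} (h : y ≤ z) : log2 y ≤ log2 z :=
  EReal.div_le_div_right_of_nonneg
    (by exact_mod_cast (Real.log_pos (by norm_num : (1 : ℝ) < 2)).le) (ENNReal.log_le_log h)

theorem log2_two_pow (s : ℕ) : log2 (2 ^ s) = s := by
  have h : ENNReal.log 2 = ((Real.log 2 : ℝ) : EReal) := by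
    simpa using ENNReal.log_of_nnreal (x := 2) two_ne_zero
  have h2 : Real.log 2 ≠ 0 := (Real.log_pos (by norm_num)).ne'
  rw [log2, ENNReal.log_pow, h, ← EReal.coe_natCast, ← EReal.coe_mul, ← EReal.coe_div,
    mul_div_cancel_right₀ _ h2]

/-- If `2⁻ˢ` is feasible, the logarithm of the inverse optimum is at most `s`. -/
theorem log2_inv_iSup_le {S : ℝ≥0 → Prop} {s : ℕ} (h : S (2 ^ s)⁻¹) :
    log2 (⨆ (ζ : ℝ≥0) (_ : S ζ), (ζ : ℝ≥0∞))⁻¹ ≤ s := by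
  rw [← log2_two_pow]
  refine log2_mono (ENNReal.inv_le_iff_inv_le.2 ?_)
  refine le_trans (le_of_eq ?_) (le_iSup₂_of_le _ h le_rfl)
  rw [ENNReal.coe_inv (by positivity)]
  norm_num

/-! ### The classical bound -/

/-- Guessing the message: the players draw the seed and a uniformly random candidate message, and
Alice aborts unless the candidate is the message that she would have sent. -/
theorem OneWayProtocol.oneWayFeasible {X Y A B : Type*} [Fintype X] [Fintype Y] [Fintype A]
    [Fintype B] [DecidableEq X] [DecidableEq Y] [DecidableEq A] [DecidableEq B]
    {p : CondDist X Y A B} {t : ℕ} (P : OneWayProtocol X Y A B t)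
    (hP : ∀ x y a b, P.prob x y a b = p.prob x y a b) : OneWayFeasible p (2 ^ t)⁻¹ := by
  let strat : Fin P.seeds × (Fin t → Bool) → LocalDet X Y (Option A) B := fun i =>
    (fun x => if P.msg i.1 x = i.2 then some (P.outA i.1 x) else none, fun y => P.outB i.1 y i.2)
  let c : Fin P.seeds × (Fin t → Bool) → ℝ := fun i => P.seedProb i.1 * (2 ^ t)⁻¹
  -- The weights are the push-forward of `c` along `strat`, since different pairs of seed and guess
  -- may induce the same strategy.
  refine ⟨fun l => ∑ i, if strat i = l then c i else 0, fun l => ?_, ?_, fun x y a b => ?_⟩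
  · refine Finset.sum_nonneg fun i _ => ?_
    split_ifs
    · exact mul_nonneg (P.seedProb_nonneg _) (by positivity)
    · exact le_rfl
  · rw [Finset.sum_comm]
    simp [c, Fintype.sum_prod_type, ← Finset.sum_mul, ← Finset.mul_sum, P.seedProb_sum]
  · simp_rw [Finset.sum_mul]
    rw [Finset.sum_comm, ← hP, OneWayProtocol.prob, Finset.mul_sum, Fintype.sum_prod_type]
    refine Finset.sum_congr rfl fun s _ => ?_
    simp only [ite_mul, zero_mul, Finset.sum_ite_eq, Finset.mem_univ, if_true]
    -- For a fixed seed exactly one guess avoids the abort.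
    rw [Finset.sum_eq_single (P.msg s x)]
    · simp [LocalDet.prob, strat, c, mul_comm]
    · intro μ _ hμ
      simp [LocalDet.prob, strat, hμ.symm]
    · simp

/-! ### Quantum distributions -/

section Quantum

variable {M N D : Type*} [Fintype M] [Fintype N] [Fintype D]

open Matrix

open scoped MatrixOrder in
theorem Matrix.PosSemidef.trace_mul_nonneg {ρ σ : Matrix M M ℂ} (hρ : ρ.PosSemidef)
    (hσ : σ.PosSemidef) : 0 ≤ (ρ * σ).trace := by
  classical
  obtain ⟨R, rfl⟩ := CStarAlgebra.nonneg_iff_eq_star_mul_self.1 hρ.nonneg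
  rw [Matrix.star_eq_conjTranspose, Matrix.mul_assoc, Matrix.trace_mul_comm]
  exact (hσ.mul_mul_conjTranspose_same R).trace_nonneg

theorem IsDensity.submatrix_equiv {ρ : Matrix M M ℂ} (h : IsDensity ρ) (e : N ≃ M) :
    IsDensity (ρ.submatrix e e) :=
  ⟨h.1.submatrix e, by rw [← h.2]; exact Equiv.sum_comp e fun i => ρ i i⟩

theorem IsPOVM.submatrix_equiv [DecidableEq M] [DecidableEq N] {O : Type*} [Fintype O]
    {E : O → Matrix M M ℂ} (h : IsPOVM E) (e : N ≃ M) :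
    IsPOVM fun o => (E o).submatrix e e := by
  refine ⟨fun o => (h.1 o).submatrix e, ?_⟩
  rw [← Matrix.submatrix_one_equiv e, ← h.2]
  ext i j
  simp [Matrix.sum_apply]

/-- Measuring a state on `ℂ^M ⊗ ℂ^N`, for arbitrary finite index types, gives a quantum
distribution. -/
theorem isQuantum_of_measurement [DecidableEq M] [DecidableEq N] {X Y A B : Type*} [Fintype A]
    [Fintype B] {ρ : Matrix (M × N) (M × N) ℂ} (hρ : IsDensity ρ) {E : X → A → Matrix M M ℂ}
    (hE : ∀ x, IsPOVM (E x)) {F : Y → B → Matrix N N ℂ} (hF : ∀ y, IsPOVM (F y)) :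
    IsQuantum fun x y a b => (ρ * (E x a ⊗ₖ F y b)).trace.re := by
  let e := (Fintype.equivFin M).symm
  let f := (Fintype.equivFin N).symm
  refine ⟨_, _, ρ.submatrix (e.prodCongr f) (e.prodCongr f), fun x a => (E x a).submatrix e e,
    fun y b => (F y b).submatrix f f, hρ.submatrix_equiv _, fun x => (hE x).submatrix_equiv e,
    fun y => (hF y).submatrix_equiv f, fun x y a b => ?_⟩
  have hr := hρ.1.trace_mul_nonneg (((hE x).1 a).kronecker ((hF y).1 b))
  -- The trace is nonnegative in the complex order, hence real, so taking the real part loses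
  -- nothing.
  rw [← Complex.eq_re_of_ofReal_le (r := 0) (by simpa using hr)]
  change _ = ((ρ.submatrix (e.prodCongr f) (e.prodCongr f)) *
    ((E x a ⊗ₖ F y b).submatrix (e.prodCongr f) (e.prodCongr f))).trace
  rw [Matrix.submatrix_mul_equiv]
  exact (Equiv.sum_comp (e.prodCongr f) fun i => (ρ * (E x a ⊗ₖ F y b)) i i).symm

/-! ### The quantum bound -/

variable [DecidableEq D]

/-- The projection onto the maximally entangled vector in `ℂ^D ⊗ ℂ^D`. -/
noncomputable def maxEntangled (D : Type*) [Fintype D] [DecidableEq D] :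
    Matrix (D × D) (D × D) ℂ :=
  fun i j => if i.1 = i.2 ∧ j.1 = j.2 then (Fintype.card D : ℂ)⁻¹ else 0

theorem conjTranspose_maxEntangled : (maxEntangled D)ᴴ = maxEntangled D := by
  ext i j
  simp only [Matrix.conjTranspose_apply, maxEntangled, and_comm]
  split_ifs <;> simp

theorem maxEntangled_mul_self [Nonempty D] :
    maxEntangled D * maxEntangled D = maxEntangled D := by
  ext ⟨i, i'⟩ ⟨j, j'⟩
  simp only [Matrix.mul_apply, maxEntangled, Fintype.sum_prod_type]
  by_cases h : i = i' <;> by_cases h' : j = j' <;> simp [h, h']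

theorem isDensity_maxEntangled [Nonempty D] : IsDensity (maxEntangled D) := by
  constructor
  · have h := Matrix.posSemidef_conjTranspose_mul_self (maxEntangled D)
    rwa [conjTranspose_maxEntangled, maxEntangled_mul_self] at h
  · simp [Matrix.trace, maxEntangled, Fintype.sum_prod_type]

/-- The complement of an orthogonal projection is again one, hence equal to its own Gram matrix. It
supplies Alice's abort outcome. -/
theorem posSemidef_one_sub_maxEntangled [Nonempty D] : (1 - maxEntangled D).PosSemidef := by
  have h := Matrix.posSemidef_conjTranspose_mul_self (1 - maxEntangled D)
  rwa [Matrix.conjTranspose_sub, Matrix.conjTranspose_one, conjTranspose_maxEntangled,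
    Matrix.sub_mul, Matrix.one_mul, Matrix.mul_sub, Matrix.mul_one,
    maxEntangled_mul_self, sub_self, sub_zero] at h

theorem IsDensity.kronecker {ρ : Matrix M M ℂ} {σ : Matrix N N ℂ} (hρ : IsDensity ρ)
    (hσ : IsDensity σ) : IsDensity (ρ ⊗ₖ σ) := by
  classical
  exact ⟨hρ.1.kronecker hσ.1, by rw [Matrix.trace_kronecker, hρ.2, hσ.2, one_mul]⟩

/-- Alice's measurement in the zero-communication simulation: she applies the instrument with Kraus
operators `K` and projects the message register and her half of a maximally entangled state onto the
maximally entangled vector, aborting when this fails. -/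
noncomputable def teleportPOVM {A R : Type*} [Fintype A] [Fintype R]
    (K : A → R → Matrix D M ℂ) : Option A → Matrix (M × D) (M × D) ℂ
  | some a => ∑ k, (K a k ⊗ₖ (1 : Matrix D D ℂ))ᴴ * maxEntangled D * (K a k ⊗ₖ (1 : Matrix D D ℂ))
  | none => ∑ a, ∑ k,
      (K a k ⊗ₖ (1 : Matrix D D ℂ))ᴴ * (1 - maxEntangled D) * (K a k ⊗ₖ (1 : Matrix D D ℂ))

theorem isPOVM_teleportPOVM [DecidableEq M] [Nonempty D] {A R : Type*} [Fintype A] [Fintype R]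
    {K : A → R → Matrix D M ℂ} (hK : ∑ a, ∑ k, (K a k)ᴴ * K a k = 1) :
    IsPOVM (teleportPOVM K) := by
  constructor
  · rintro (_ | a)
    · exact Matrix.posSemidef_sum _ fun a _ => Matrix.posSemidef_sum _ fun k _ =>
        posSemidef_one_sub_maxEntangled.conjTranspose_mul_mul_same _
    · exact Matrix.posSemidef_sum _ fun k _ =>
        isDensity_maxEntangled.1.conjTranspose_mul_mul_same _
  · rw [Fintype.sum_option]
    -- For each Kraus operator the success and abort terms add up to `(K a k)ᴴ * K a k ⊗ₖ 1`, so
    -- completeness reduces to `hK`.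
    simp only [teleportPOVM, ← Finset.sum_add_distrib, ← Matrix.add_mul, ← Matrix.mul_add,
      sub_add_cancel, Matrix.mul_one]
    have h (a k) : (K a k ⊗ₖ (1 : Matrix D D ℂ))ᴴ * (K a k ⊗ₖ (1 : Matrix D D ℂ)) =
        ((K a k)ᴴ * K a k) ⊗ₖ (1 : Matrix D D ℂ) := by
      rw [Matrix.conjTranspose_kronecker, ← Matrix.mul_kronecker_mul, Matrix.conjTranspose_one,
        Matrix.mul_one]
    simp only [h]
    rw [← Matrix.one_kronecker_one, ← hK]
    ext i j
    simp [Matrix.sum_apply, Finset.sum_mul]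

-- The maximally entangled vector identifies the register index of `K` with the index `μ` of Alice's
-- half of the pair, so the product is the rank-one matrix built from the entries of `K`.
omit [Fintype M] in
theorem conj_maxEntangled_apply (K : Matrix D M ℂ) (i i' : M) (μ μ' : D) :
    ((K ⊗ₖ (1 : Matrix D D ℂ))ᴴ * maxEntangled D * (K ⊗ₖ (1 : Matrix D D ℂ))) (i', μ') (i, μ) =
      (Fintype.card D : ℂ)⁻¹ * (star (K μ' i') * K μ i) := by
  simp only [Matrix.mul_apply, maxEntangled, Fintype.sum_prod_type, Matrix.conjTranspose_apply,
    Matrix.kroneckerMap_apply, Matrix.one_apply, mul_ite, mul_one, mul_zero, apply_ite star,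
    star_zero, ite_mul, zero_mul, ite_and, Finset.sum_ite_irrel,
    Finset.sum_const_zero, Finset.sum_ite_eq, Finset.sum_ite_eq', Finset.mem_univ, if_true]
  ring

/-- The rearrangement of the tensor factors that gives each player one half of the maximally
entangled state. -/
def shareEquiv (M N D : Type*) : (M × D) × (D × N) ≃ (M × N) × (D × D) :=
  ((Equiv.refl _).prodCongr (Equiv.prodComm D N)).trans (Equiv.prodProdProdComm M D N D)

omit [DecidableEq D] in
theorem trace_conj_kronecker_one_mul [DecidableEq N]
    (ρ : Matrix (M × N) (M × N) ℂ) (K : Matrix D M ℂ)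
    (F : Matrix (D × N) (D × N) ℂ) :
    ((K ⊗ₖ (1 : Matrix N N ℂ)) * ρ * (K ⊗ₖ (1 : Matrix N N ℂ))ᴴ * F).trace =
    ∑ μ, ∑ j, ∑ μ', ∑ j', ∑ i', ∑ i,
      K μ i * ρ (i, j) (i', j') * star (K μ' i') * F (μ', j') (μ, j) := by
  simp [Matrix.trace, Matrix.mul_apply, Fintype.sum_prod_type, Matrix.one_apply, Finset.sum_mul,
    apply_ite star]

theorem trace_teleport_eq_sum (ρ : Matrix (M × N) (M × N) ℂ) (K : Matrix D M ℂ)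
    (F : Matrix (D × N) (D × N) ℂ) :
    ((ρ ⊗ₖ maxEntangled D).submatrix (shareEquiv M N D) (shareEquiv M N D) *
    (((K ⊗ₖ (1 : Matrix D D ℂ))ᴴ * maxEntangled D * (K ⊗ₖ (1 : Matrix D D ℂ))) ⊗ₖ F)).trace =
    ∑ i, ∑ μ, ∑ j, ∑ i', ∑ μ', ∑ j', (Fintype.card D : ℂ)⁻¹ ^ 2 *
      (K μ i * ρ (i, j) (i', j') * star (K μ' i') * F (μ', j') (μ, j)) := by
  simp only [Matrix.trace, Matrix.diag_apply, Matrix.mul_apply (M := Matrix.submatrix _ _ _),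
    Fintype.sum_prod_type, Matrix.kroneckerMap_apply, Matrix.submatrix_apply,
    conj_maxEntangled_apply]
  simp only [shareEquiv, maxEntangled, Equiv.trans_apply, Equiv.prodCongr_apply, Prod.map,
    Equiv.refl_apply, Equiv.prodComm_apply, Prod.swap, Equiv.prodProdProdComm_apply, mul_ite,
    mul_zero, ite_mul, zero_mul, ite_and]
  refine Finset.sum_congr rfl fun i _ => Finset.sum_congr rfl fun μ _ => ?_
  -- The shared pair forces Bob's register indices to equal Alice's, which collapses two sums. One
  -- factor `1 / |D|` comes from this pair, the other from Alice's projection.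
  simp only [Finset.sum_ite_irrel, Finset.sum_const_zero, Finset.sum_ite_eq, Finset.mem_univ,
    if_true]
  refine Finset.sum_congr rfl fun j _ => Finset.sum_congr rfl fun i' _ =>
    Finset.sum_congr rfl fun μ' _ => Finset.sum_congr rfl fun j' _ => ?_
  ring

/-- Projecting onto the maximally entangled vector teleports the message register with success
probability `1 / |D|²`. -/
theorem trace_teleport [DecidableEq N] (ρ : Matrix (M × N) (M × N) ℂ) (K : Matrix D M ℂ)
    (F : Matrix (D × N) (D × N) ℂ) :
    ((ρ ⊗ₖ maxEntangled D).submatrix (shareEquiv M N D) (shareEquiv M N D) *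
      (((K ⊗ₖ (1 : Matrix D D ℂ))ᴴ * maxEntangled D * (K ⊗ₖ (1 : Matrix D D ℂ))) ⊗ₖ F)).trace =
      (Fintype.card D : ℂ)⁻¹ ^ 2 *
        ((K ⊗ₖ (1 : Matrix N N ℂ)) * ρ * (K ⊗ₖ (1 : Matrix N N ℂ))ᴴ * F).trace := by
  rw [trace_teleport_eq_sum, trace_conj_kronecker_one_mul]
  simp only [Finset.mul_sum]
  rw [Finset.sum_comm]
  refine Finset.sum_congr rfl fun μ _ => ?_
  rw [Finset.sum_comm]
  refine Finset.sum_congr rfl fun j _ => ?_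
  calc
    _ = ∑ i, ∑ μ', ∑ i', ∑ j', _ := Finset.sum_congr rfl fun _ _ => Finset.sum_comm
    _ = ∑ μ', ∑ i, ∑ i', ∑ j', _ := Finset.sum_comm
    _ = ∑ μ', ∑ i, ∑ j', ∑ i', _ :=
      Finset.sum_congr rfl fun _ _ => Finset.sum_congr rfl fun _ _ => Finset.sum_comm
    _ = ∑ μ', ∑ j', ∑ i, ∑ i', _ := Finset.sum_congr rfl fun _ _ => Finset.sum_comm
    _ = _ := Finset.sum_congr rfl fun _ _ => Finset.sum_congr rfl fun _ _ => Finset.sum_comm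

end Quantum

/-- A one-way quantum protocol is simulated without communication by teleportation without
correction, which succeeds with probability `4⁻ᵗ`. -/
theorem QOneWayProtocol.qOneWayFeasible {X Y A B : Type*} [Fintype A] [Fintype B]
    {p : CondDist X Y A B} {t : ℕ} (P : QOneWayProtocol X Y A B t)
    (hP : ∀ x y a b, P.prob x y a b = ((p.prob x y a b : ℝ) : ℂ)) :
    QOneWayFeasible p (2 ^ (2 * t))⁻¹ := by
  refine ⟨_, isQuantum_of_measurement
    ((P.isDensity.kronecker isDensity_maxEntangled).submatrix_equiv
      (shareEquiv (Fin P.m) (Fin P.n) (Fin t → Bool)))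
    (fun x => isPOVM_teleportPOVM (P.kraus_sum x)) P.isPOVM, fun x y a b => ?_⟩
  have h (S : Matrix (Fin P.m × (Fin t → Bool)) (Fin P.m × (Fin t → Bool)) ℂ)
      (hS : S = teleportPOVM (P.K x) (some a)) :
      (((P.ρ ⊗ₖ maxEntangled (Fin t → Bool)).submatrix (shareEquiv _ _ _) (shareEquiv _ _ _)) *
        (S ⊗ₖ P.F y b)).trace = (((2 ^ (2 * t))⁻¹ * p.prob x y a b : ℝ) : ℂ) := by
    have hsum (G : Fin P.r → Matrix (Fin P.m × (Fin t → Bool)) (Fin P.m × (Fin t → Bool)) ℂ) :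
        (∑ k, G k) ⊗ₖ P.F y b = ∑ k, G k ⊗ₖ P.F y b := by
      ext i j
      simp [Matrix.sum_apply, Finset.sum_mul]
    rw [hS, teleportPOVM, hsum, Matrix.mul_sum, Matrix.trace_sum]
    simp only [trace_teleport]
    rw [← Finset.mul_sum, Complex.ofReal_mul, ← hP, QOneWayProtocol.prob, QOneWayProtocol.post,
      Finset.sum_mul, Matrix.trace_sum]
    congr 1
    -- Here `|D| = 2 ^ t`, so the success probability `1 / |D|²` is `(2 ^ (2 * t))⁻¹`.
    simp [pow_mul, pow_right_comm]
  rw [h _ rfl, Complex.ofReal_re]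
  push_cast
  rfl

theorem theorem3p7 {X Y A B : Type*} [Fintype X] [Fintype Y] [Fintype A] [Fintype B]
    [DecidableEq X] [DecidableEq Y] [DecidableEq A] [DecidableEq B] (p : CondDist X Y A B) :
    oneWayComplexity p ≥ log2 (effOneWay p) ∧
      qOneWayComplexity p ≥ ((1 / 2 : ℝ) : EReal) * log2 (qEffOneWay p) := by
  refine ⟨le_iInf₂ fun t ⟨P, hP⟩ => log2_inv_iSup_le (P.oneWayFeasible hP),
    le_iInf₂ fun t ⟨P, hP⟩ => ?_⟩
  -- Feasibility of `2 ^ (-2t)` bounds the logarithm by `2 * t`; the factor `1 / 2` brings this back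
  -- to `t`.
  refine (mul_le_mul_of_nonneg_left (log2_inv_iSup_le (P.qOneWayFeasible hP))
    (by exact_mod_cast (by norm_num : (0 : ℝ) ≤ 1 / 2))).trans (le_of_eq ?_)
  rw [← EReal.coe_natCast, ← EReal.coe_natCast, ← EReal.coe_mul, Nat.cast_mul, Nat.cast_ofNat,
    one_div, inv_mul_cancel_left₀ two_ne_zero]
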